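/- Let $k\ge 1$, let $\mathcal H=(\mathbb C^2)^{\otimes k}=\mathbb C^{2^k}$, and let $\mathcal D(\mathcal H)$ be the set of density operators on $\mathcal H$ (positive semidefinite, trace one). A set $T$ of anti-Hermitian operators on $\mathcal H$ is called a *Hörmander system* if the real Lie algebra generated by $T$ under the commutator is $\mathfrak{su}(2^k)$, the traceless anti-Hermitian operators. For a set $S\subset\mathbb B(\mathcal H)$, let $\overline{\mathrm{chan}^*(S)}$ be the smallest set $\mathcal E$ of linear maps on $\mathbb B(\mathcal H)$ such that - (UN) if $H=H^*$ and $iH$ lies in the complex linear span of $S$, then $\rho\mapsto e^{itH}\rho e^{-itH}$ belongs to $\mathcal E$ for every $t\ge 0$; - (JU) if $a\in S$, then $e^{tL_a}\in\mathcal E$ for every $t\ge 0$, where $L_a(\rho)=2a\rho a^*-a^*a\rho-\rho a^*a$; - (CO) $\mathcal E$ is closed under composition; - (CL) $\mathcal E$ is topologically closed; - (CV) $\mathcal E$ is convex. **Theorem.** Let $S\subset\mathbb B(\mathcal H)$ be a set of operators whose complex linear span contains a Hörmander system, and suppose that $|0\rangle\langle 1|\otimes I^{\otimes (k-1)}\in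 S$. Then for every $\sigma\in\mathcal D(\mathcal H)$ the replacer channel $\mathcal R_\sigma(\rho)=\mathrm{tr}(\rho)\,\sigma$ belongs to $\overline{\mathrm{chan}^*(S)}$. In particular $\overline{\mathrm{chan}^*(S)}$ is transitive: for all $\rho,\sigma\in\mathcal D(\mathcal H)$ there is $\Phi\in\overline{\mathrm{chan}^*(S)}$ with $\Phi(\rho)=\sigma$. -/

import Mathlib

open scoped Matrix Matrix.Norms.L2Operator ComplexOrder

attribute [local instance] LieRing.ofAssociativeRing

noncomputable section

namespace QControl

/-- Operators on `ℂ^n`, as complex matrices with rows and columns indexed by `n`.  The norm is the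
operator norm; since the dimension is finite, the topology does not depend on that choice. -/
abbrev Op (n : Type) [Fintype n] [DecidableEq n] : Type := Matrix n n ℂ

/-- Superoperators: the (automatically continuous) linear maps on the operators. -/
abbrev SuperOp (n : Type) [Fintype n] [DecidableEq n] : Type := Op n →L[ℂ] Op n

/-- The index set of the computational basis of `k` qubits: a basis vector is a bit string.
The space `ℂ^(Qubits k)` is `(ℂ²)^{⊗k} = ℂ^(2^k)`. -/
abbrev Qubits (k : ℕ) : Type := Fin k → Fin 2

/-- The tensor product `A₁ ⊗ ⋯ ⊗ A_k` of one-qubit operators. -/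
def tensorOp {k : ℕ} (A : Fin k → Op (Fin 2)) : Op (Qubits k) :=
  Matrix.of fun x y => ∏ j, A j (x j) (y j)

/-- The one-qubit operator `|0⟩⟨1|`. -/
def ketZeroBraOne : Op (Fin 2) := Matrix.single 0 1 1

/-- The operator `|0⟩⟨1| ⊗ I ⊗ ⋯ ⊗ I` on `k ≥ 1` qubits. -/
def firstQubitLowering (k : ℕ) (hk : 1 ≤ k) : Op (Qubits k) :=
  tensorOp fun j => if j = ⟨0, hk⟩ then ketZeroBraOne else 1

section General

variable {n : Type} [Fintype n] [DecidableEq n]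

/-- The set `𝒟(ℋ)` of density operators. -/
def densities (n : Type) [Fintype n] [DecidableEq n] : Set (Op n) :=
  {ρ | ρ.PosSemidef ∧ ρ.trace = 1}

/-- The real Lie algebra `𝔰𝔲(n)` of traceless anti-Hermitian operators, with the commutator. -/
def su (n : Type) [Fintype n] [DecidableEq n] : LieSubalgebra ℝ (Op n) where
  carrier := {A | Aᴴ = -A ∧ A.trace = 0}
  zero_mem' := by simp
  add_mem' := by
    rintro A B ⟨hA, hA'⟩ ⟨hB, hB'⟩
    refine ⟨?_, by simp [hA', hB']⟩
    rw [Matrix.conjTranspose_add, hA, hB]; abel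
  smul_mem' := by
    rintro c A ⟨hA, hA'⟩
    refine ⟨?_, by simp [hA']⟩
    rw [Matrix.conjTranspose_smul, hA]; simp
  lie_mem' := by
    rintro A B ⟨hA, _⟩ ⟨hB, _⟩
    refine ⟨?_, ?_⟩
    · simp only [Ring.lie_def, Matrix.conjTranspose_sub, Matrix.conjTranspose_mul, hA, hB]
      noncomm_ring
    · simp only [Ring.lie_def, Matrix.trace_sub, Matrix.trace_mul_comm A B, sub_self]

/-- A Hörmander system: a set of anti-Hermitian operators such that the real Lie algebra which it
generates is all of `𝔰𝔲(n)`. -/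
def IsHormander (T : Set (Op n)) : Prop :=
  (∀ A ∈ T, Aᴴ = -A) ∧ LieSubalgebra.lieSpan ℝ (Op n) T = su n

/-- The superoperator `ρ ↦ A ρ B`. -/
def sandwich (A B : Op n) : SuperOp n :=
  LinearMap.toContinuousLinearMap (LinearMap.mulLeftRight ℂ (A, B))

/-- The unitary evolution `ρ ↦ e^{itH} ρ e^{-itH}`. -/
def unitaryEvolution (H : Op n) (t : ℝ) : SuperOp n :=
  sandwich (NormedSpace.exp ((t * Complex.I : ℂ) • H))
    (NormedSpace.exp (-(t * Complex.I : ℂ) • H))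

/-- The Lindblad generator `L_a(ρ) = 2 a ρ a* - a* a ρ - ρ a* a` of the jump operator `a`. -/
def lindblad (a : Op n) : SuperOp n :=
  (2 : ℂ) • sandwich a aᴴ - sandwich (aᴴ * a) 1 - sandwich 1 (aᴴ * a)

/-- The evolution `e^{t L_a}`. -/
def jumpEvolution (a : Op n) (t : ℝ) : SuperOp n :=
  NormedSpace.exp ((t : ℂ) • lindblad a)

/-- The closure properties of a class `E` of evolutions with resource set `S`. -/
structure IsClosedConvexClass (S : Set (Op n)) (E : Set (SuperOp n)) : Prop where
  unitary_mem : ∀ H : Op n, H.IsHermitian → Complex.I • H ∈ Submodule.span ℂ S →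
    ∀ t : ℝ, 0 ≤ t → unitaryEvolution H t ∈ E
  jump_mem : ∀ a ∈ S, ∀ t : ℝ, 0 ≤ t → jumpEvolution a t ∈ E
  comp_mem : ∀ Φ ∈ E, ∀ Ψ ∈ E, Φ.comp Ψ ∈ E
  closed : IsClosed E
  convex : Convex ℝ E

/-- The closed convex class generated by `S`: the smallest set of superoperators that contains the
unitary evolutions with generator in the span of `S` and the evolutions of the jump operators in
`S`, and that is closed under composition, topologically closed, and convex. -/
def closedConvexChan (S : Set (Op n)) : Set (SuperOp n) :=
  ⋂₀ {E | IsClosedConvexClass S E}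

/-- The replacer channel `R_σ(ρ) = tr(ρ) σ`. -/
def replacer (σ : Op n) : SuperOp n :=
  LinearMap.toContinuousLinearMap ((Matrix.traceLinearMap n ℂ ℂ).smulRight σ)

/-- A set `O` of operations is transitive if it moves every density to every density. -/
def IsTransitive (O : Set (SuperOp n)) : Prop :=
  ∀ ρ ∈ densities n, ∀ σ ∈ densities n, ∃ Φ ∈ O, Φ ρ = σ

end General

end QControl

end

/-! Fix any class `E` closed under the five rules. The unitaries whose conjugation lies in `E` form
a closed submonoid, and the skew-adjoint generators of its one-parameter groups form a real Lie
algebra: sums come from the Lie product formula, commutators from differentiating conjugations. It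
contains the Hörmander system, hence all of `su` (`su_le_lieAlgebra`). A Hermitian involution is a
phase times an exponential from `su`, and conjugation ignores phases, so conjugation by any such
involution is in `E` (`sandwich_involution_mem`). Only qubit swaps and Householder reflections are
needed.

The jump operator `a` on the first qubit satisfies `a² = 0` and `a a* a = a`. This makes `L_a`
diagonalizable with eigenvalues among 0, -1, -2, so `e^{tL_a}` converges to a channel resetting that
qubit to `|0⟩` (`tendsto_jumpEvolution`). Swaps carry this reset to every qubit, and the composite
of all resets is the replacer of `|0…0⟩` (`replacer_zero_mem`). Reflections turn it into the
replacer of any pure state; the spectral theorem and convexity give every density (`replacer_mem`).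
-/

noncomputable section

namespace QControl

open Filter Topology

/-! ### Exponentials of combinations of orthogonal idempotents -/

section Idempotents

variable {𝔸 : Type*} [Ring 𝔸] [Algebra ℂ 𝔸] {P Q : 𝔸}

theorem smul_add_smul_pow_succ (hP : IsIdempotentElem P) (hQ : IsIdempotentElem Q)
    (hPQ : P * Q = 0) (hQP : Q * P = 0) (z w : ℂ) (n : ℕ) :
    (z • P + w • Q) ^ (n + 1) = z ^ (n + 1) • P + w ^ (n + 1) • Q := by
  induction n with
  | zero => simp
  | succ n ih =>
    rw [pow_succ, ih]
    simp only [add_mul, mul_add, smul_mul_smul_comm, hP.eq, hQ.eq, hPQ, hQP, smul_zero,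
      add_zero, zero_add, ← pow_succ]

variable [TopologicalSpace 𝔸] [IsTopologicalRing 𝔸] [ContinuousSMul ℂ 𝔸] [T2Space 𝔸]

theorem exp_smul_add_smul_of_orthogonal (hP : IsIdempotentElem P) (hQ : IsIdempotentElem Q)
    (hPQ : P * Q = 0) (hQP : Q * P = 0) (z w : ℂ) :
    NormedSpace.exp (z • P + w • Q) =
      1 + (Complex.exp z - 1) • P + (Complex.exp w - 1) • Q := by
  have he : ∀ z : ℂ, HasSum (fun n : ℕ => ((n.factorial : ℂ)⁻¹) • z ^ n) (Complex.exp z) := by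
    intro z
    rw [Complex.exp_eq_exp_ℂ]; exact NormedSpace.exp_series_hasSum_exp' (𝕂 := ℂ) z
  -- The power formula fails at exponent 0, where the power is `1` rather than `P + Q`; the extra
  -- term `1 - P - Q` corrects this.
  have h := (((he z).smul_const P).add ((he w).smul_const Q)).add
    (hasSum_ite_eq (0 : ℕ) (1 - P - Q))
  have heq : (fun n : ℕ => (((n.factorial : ℂ)⁻¹) • z ^ n) • P +
      (((n.factorial : ℂ)⁻¹) • w ^ n) • Q + if n = 0 then 1 - P - Q else 0)
      = fun n : ℕ => ((n.factorial : ℂ)⁻¹) • (z • P + w • Q) ^ n := by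
    funext n
    rcases n with _ | n
    · simp
    · rw [smul_add_smul_pow_succ hP hQ hPQ hQP]
      simp [smul_smul]
  rw [heq] at h
  rw [NormedSpace.exp_eq_tsum ℂ]
  refine h.tsum_eq.trans ?_
  module

theorem exp_smul_of_isIdempotentElem (hP : IsIdempotentElem P) (z : ℂ) :
    NormedSpace.exp (z • P) = 1 + (Complex.exp z - 1) • P := by
  simpa using exp_smul_add_smul_of_orthogonal hP IsIdempotentElem.zero (mul_zero P)
    (zero_mul P) z 0

/-- The large time limit of a semigroup whose generator has the spectral decomposition
`-P - 2 Q`. -/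
theorem tendsto_exp_of_orthogonal_idempotents (hP : IsIdempotentElem P)
    (hQ : IsIdempotentElem Q) (hPQ : P * Q = 0) (hQP : Q * P = 0) :
    Tendsto (fun t : ℝ => NormedSpace.exp ((t : ℂ) • (-P - (2 : ℂ) • Q))) atTop
      (𝓝 (1 - P - Q)) := by
  have hlim : 1 - P - Q = 1 + (0 - 1 : ℂ) • P + (0 - 1 : ℂ) • Q := by module
  have hexp : ∀ t : ℝ, NormedSpace.exp ((t : ℂ) • (-P - (2 : ℂ) • Q)) =
      1 + (Complex.exp (-t) - 1) • P + (Complex.exp (-(2 * t)) - 1) • Q := by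
    intro t
    rw [← exp_smul_add_smul_of_orthogonal hP hQ hPQ hQP]
    congr 1
    module
  have hdecay : ∀ c : ℝ, 0 < c →
      Tendsto (fun t : ℝ => Complex.exp (-(c * t : ℂ))) atTop (𝓝 0) := by
    intro c hc
    rw [tendsto_zero_iff_norm_tendsto_zero]
    simp only [Complex.norm_exp]
    have : Tendsto (fun t : ℝ => Real.exp (-(c * t))) atTop (𝓝 0) :=
      Real.tendsto_exp_neg_atTop_nhds_zero.comp (tendsto_id.const_mul_atTop hc)
    simpa using this
  rw [hlim, funext hexp]
  have t1 := hdecay 1 one_pos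
  have t2 := hdecay 2 two_pos
  simp only [Complex.ofReal_one, one_mul, Complex.ofReal_ofNat] at t1 t2
  exact (((t1.sub_const 1).smul_const P).const_add 1).add ((t2.sub_const 1).smul_const Q)

end Idempotents

/-! ### The Lie algebra of a closed submonoid of unitaries -/

section OneParameterGroups

set_option linter.unusedSectionVars false

variable {𝔸 : Type*} [NormedRing 𝔸] [NormedAlgebra ℂ 𝔸] [CompleteSpace 𝔸]

theorem hasDerivAt_exp_smul_zero (X : 𝔸) :
    HasDerivAt (fun t : ℝ => NormedSpace.exp (t • X)) X 0 := by
  have h : HasFDerivAt (NormedSpace.exp : 𝔸 → 𝔸) (1 : 𝔸 →L[ℝ] 𝔸) ((0 : ℝ) • X) := by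
    rw [zero_smul]; exact hasFDerivAt_exp_zero
  have h2 : HasDerivAt (fun t : ℝ => t • X) ((1 : ℝ) • X) 0 := (hasDerivAt_id 0).smul_const X
  exact (h.comp_hasDerivAt (0 : ℝ) h2).congr_deriv (by simp)

variable [StarRing 𝔸] [CStarRing 𝔸] [StarModule ℂ 𝔸]

theorem norm_le_one_of_mem_unitary {U : 𝔸} (hU : U ∈ unitary 𝔸) : ‖U‖ ≤ 1 := by
  rcases subsingleton_or_nontrivial 𝔸 with h | h
  · simp [Subsingleton.elim U 0]
  · exact (CStarRing.norm_of_mem_unitary hU).le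

/-- Telescoping: powers of unitaries are contractions, so errors only add up. -/
theorem norm_pow_sub_pow_le_of_unitary {U V : 𝔸} (hU : U ∈ unitary 𝔸) (hV : V ∈ unitary 𝔸)
    (n : ℕ) : ‖U ^ n - V ^ n‖ ≤ n * ‖U - V‖ := by
  induction n with
  | zero => simp
  | succ n ih =>
    have h : U ^ (n + 1) - V ^ (n + 1) = (U ^ n - V ^ n) * U + V ^ n * (U - V) := by
      rw [pow_succ, pow_succ]; noncomm_ring
    have h1 := norm_le_one_of_mem_unitary hU
    have h2 := norm_le_one_of_mem_unitary (pow_mem hV n)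
    calc ‖U ^ (n + 1) - V ^ (n + 1)‖ ≤ ‖U ^ n - V ^ n‖ * ‖U‖ + ‖V ^ n‖ * ‖U - V‖ := by
          rw [h]
          exact (norm_add_le _ _).trans (add_le_add (norm_mul_le _ _) (norm_mul_le _ _))
      _ ≤ (n * ‖U - V‖) * 1 + 1 * ‖U - V‖ := by gcongr
      _ = _ := by push_cast; ring

theorem exp_real_smul_mem_unitary {X : 𝔸} (hX : star X = -X) (t : ℝ) :
    NormedSpace.exp (t • X) ∈ unitary 𝔸 := by
  let _ := NormedAlgebra.restrictScalars ℚ ℂ 𝔸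
  refine NormedSpace.exp_mem_unitary_of_mem_skewAdjoint ?_
  rw [skewAdjoint.mem_iff, ← Complex.coe_smul, star_smul, hX]
  simp

/-- The Lie product formula, for skew-adjoint elements. -/
theorem tendsto_exp_mul_exp_pow {X Y : 𝔸} (hX : star X = -X) (hY : star Y = -Y) :
    Tendsto (fun n : ℕ => (NormedSpace.exp (((n : ℝ)⁻¹) • X) *
      NormedSpace.exp (((n : ℝ)⁻¹) • Y)) ^ n) atTop (𝓝 (NormedSpace.exp (X + Y))) := by
  let _ := NormedAlgebra.restrictScalars ℚ ℂ 𝔸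
  have hXY : star (X + Y) = -(X + Y) := by rw [star_add, hX, hY]; abel
  let g : ℝ → 𝔸 := fun t => NormedSpace.exp (t • X) * NormedSpace.exp (t • Y) -
    NormedSpace.exp (t • (X + Y))
  -- The two sides agree to first order, so `g (1/n) = o(1/n)` and `n` accumulated errors still
  -- vanish.
  have hg : HasDerivAt g 0 0 := by
    exact (((hasDerivAt_exp_smul_zero X).mul (hasDerivAt_exp_smul_zero Y)).sub
      (hasDerivAt_exp_smul_zero (X + Y))).congr_deriv (by simp)
  have hlim : Tendsto (fun n : ℕ => (n : ℝ) * ‖g ((n : ℝ)⁻¹)‖) atTop (𝓝 0) := by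
    have h1 := (hasDerivAt_iff_tendsto_slope_zero.1 hg).norm
    have h2 : Tendsto (fun n : ℕ => (n : ℝ)⁻¹) atTop (𝓝[≠] 0) := by
      refine tendsto_nhdsWithin_iff.2 ⟨tendsto_inv_atTop_nhds_zero_nat, ?_⟩
      filter_upwards [eventually_gt_atTop 0] with n hn
      simp [hn.ne']
    have h3 := h1.comp h2
    rw [norm_zero] at h3
    refine h3.congr fun n => ?_
    simp [g, norm_smul]
  rw [tendsto_iff_norm_sub_tendsto_zero]
  refine squeeze_zero' (Eventually.of_forall fun _ => norm_nonneg _) ?_ hlim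
  filter_upwards [eventually_gt_atTop 0] with n hn
  have h1 : NormedSpace.exp (X + Y) = NormedSpace.exp (((n : ℝ)⁻¹) • (X + Y)) ^ n := by
    rw [← NormedSpace.exp_nsmul, ← Nat.cast_smul_eq_nsmul ℝ, smul_smul,
      mul_inv_cancel₀ (by positivity), one_smul]
  rw [h1]
  exact norm_pow_sub_pow_le_of_unitary
    (mul_mem (exp_real_smul_mem_unitary hX _) (exp_real_smul_mem_unitary hY _))
    (exp_real_smul_mem_unitary hXY _) n

/-- The skew-adjoint generators of the one-parameter groups that lie in `M`. -/
def infinitesimalGenerators (M : Submonoid 𝔸) : Set 𝔸 :=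
  {X | star X = -X ∧ ∀ t : ℝ, NormedSpace.exp (t • X) ∈ M}

variable {M : Submonoid 𝔸}

theorem zero_mem_infinitesimalGenerators : (0 : 𝔸) ∈ infinitesimalGenerators M :=
  ⟨by simp, fun t => by simp [one_mem]⟩

theorem smul_mem_infinitesimalGenerators (c : ℝ) {X : 𝔸} (hX : X ∈ infinitesimalGenerators M) :
    c • X ∈ infinitesimalGenerators M := by
  refine ⟨?_, fun t => ?_⟩
  · rw [← Complex.coe_smul, star_smul, hX.1]; simp
  · rw [smul_smul]; exact hX.2 _

theorem add_mem_infinitesimalGenerators (hM : IsClosed (M : Set 𝔸)) {X Y : 𝔸}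
    (hX : X ∈ infinitesimalGenerators M) (hY : Y ∈ infinitesimalGenerators M) :
    X + Y ∈ infinitesimalGenerators M := by
  refine ⟨by rw [star_add, hX.1, hY.1]; abel, fun t => ?_⟩
  have hX' := smul_mem_infinitesimalGenerators t hX
  have hY' := smul_mem_infinitesimalGenerators t hY
  rw [smul_add]
  exact hM.mem_of_tendsto (tendsto_exp_mul_exp_pow hX'.1 hY'.1) <|
    Eventually.of_forall fun n => pow_mem (mul_mem (hX'.2 _) (hY'.2 _)) n

theorem isClosed_infinitesimalGenerators (hM : IsClosed (M : Set 𝔸)) :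
    IsClosed (infinitesimalGenerators M) := by
  let _ := NormedAlgebra.restrictScalars ℚ ℂ 𝔸
  have h : infinitesimalGenerators M =
      {X : 𝔸 | star X = -X} ∩ ⋂ t : ℝ, (fun X : 𝔸 => NormedSpace.exp (t • X)) ⁻¹' M := by
    ext X; simp [infinitesimalGenerators]
  rw [h]
  refine (isClosed_eq continuous_star continuous_neg).inter (isClosed_iInter fun t => ?_)
  exact hM.preimage (NormedSpace.exp_continuous.comp (continuous_const_smul t))

/-- The commutator is the velocity at 0 of `s ↦ e^{sX} Y e^{-sX}`. This curve stays among the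
generators, which form a closed real subspace, so its difference quotients and their limit do too.
-/
theorem lie_mem_infinitesimalGenerators (hM : IsClosed (M : Set 𝔸)) {X Y : 𝔸}
    (hX : X ∈ infinitesimalGenerators M) (hY : Y ∈ infinitesimalGenerators M) :
    X * Y - Y * X ∈ infinitesimalGenerators M := by
  let _ := NormedAlgebra.restrictScalars ℚ ℂ 𝔸
  let g : ℝ → 𝔸 := fun s => NormedSpace.exp (s • X) * Y * NormedSpace.exp (s • (-X))
  have hinv : ∀ s : ℝ, NormedSpace.exp (s • (-X)) * NormedSpace.exp (s • X) = 1 := fun s => by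
    rw [← NormedSpace.exp_add_of_commute]
    · simp
    · rw [smul_neg]; exact (Commute.refl _).neg_left
  have hinv' : ∀ s : ℝ, NormedSpace.exp (s • X) * NormedSpace.exp (s • (-X)) = 1 := fun s => by
    simpa using hinv (-s)
  have hgmem : ∀ s, g s ∈ infinitesimalGenerators M := fun s => by
    have hstar : star (NormedSpace.exp (s • X)) = NormedSpace.exp (s • (-X)) := by
      rw [NormedSpace.star_exp, ← Complex.coe_smul, star_smul, hX.1]; simp
    have hstar' : star (NormedSpace.exp (s • (-X))) = NormedSpace.exp (s • X) := by
      rw [← hstar, star_star]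
    refine ⟨?_, fun t => ?_⟩
    · simp only [g, star_mul, hstar, hstar', hY.1]; noncomm_ring
    · have : NormedSpace.exp (t • g s) =
          NormedSpace.exp (s • X) * NormedSpace.exp (t • Y) * NormedSpace.exp (s • (-X)) := by
        let u : 𝔸ˣ := ⟨NormedSpace.exp (s • X), NormedSpace.exp (s • (-X)), hinv' s, hinv s⟩
        have := NormedSpace.exp_units_conj u (t • Y)
        simpa [u, g] using this
      rw [this]
      refine mul_mem (mul_mem (hX.2 _) (hY.2 _)) ?_
      rw [smul_neg, ← neg_smul]
      exact hX.2 _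
  have hg : HasDerivAt g (X * Y - Y * X) 0 := by
    exact (((hasDerivAt_exp_smul_zero X).mul_const Y).mul
      (hasDerivAt_exp_smul_zero (-X))).congr_deriv (by simp [sub_eq_add_neg])
  refine (isClosed_infinitesimalGenerators hM).mem_of_tendsto
    (hasDerivAt_iff_tendsto_slope_zero.1 hg) <| Eventually.of_forall fun s => ?_
  refine smul_mem_infinitesimalGenerators _ ?_
  rw [sub_eq_add_neg, ← neg_one_smul ℝ]
  exact add_mem_infinitesimalGenerators hM (hgmem _)
    (smul_mem_infinitesimalGenerators _ (hgmem _))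

end OneParameterGroups

/-! ### Unitary conjugations available in a closed convex class -/

section Evolutions

variable {n : Type} [Fintype n] [DecidableEq n] {S : Set (Op n)} {E : Set (SuperOp n)}

@[simp]
theorem sandwich_apply (A B ρ : Op n) : sandwich A B ρ = A * ρ * B := rfl

@[simp]
theorem replacer_apply (σ ρ : Op n) : replacer σ ρ = ρ.trace • σ := rfl

theorem sandwich_comp (A B C D : Op n) :
    (sandwich A B).comp (sandwich C D) = sandwich (A * C) (D * B) := by
  ext1 ρ; simp [mul_assoc]

theorem sandwich_smul_smul (z w : ℂ) (A B : Op n) :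
    sandwich (z • A) (w • B) = (z * w) • sandwich A B := by
  ext1 ρ; simp [smul_smul, mul_comm]

theorem continuous_sandwich_star : Continuous fun U : Op n => sandwich U (star U) := by
  rw [continuous_clm_apply]
  intro ρ
  simp only [sandwich_apply]
  fun_prop

theorem IsClosedConvexClass.sandwich_one_mem (hE : IsClosedConvexClass S E) :
    sandwich 1 1 ∈ E := by
  have := hE.unitary_mem 0 Matrix.isHermitian_zero (by simp) 0 le_rfl
  simpa [unitaryEvolution] using this

/-- The unitaries whose conjugation belongs to the class `E`. -/
def IsClosedConvexClass.unitaries (hE : IsClosedConvexClass S E) : Submonoid (Op n) where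
  carrier := {U | U ∈ unitary (Op n) ∧ sandwich U (star U) ∈ E}
  one_mem' := ⟨one_mem _, by simpa using hE.sandwich_one_mem⟩
  mul_mem' := by
    rintro U V ⟨hU, hU'⟩ ⟨hV, hV'⟩
    refine ⟨mul_mem hU hV, ?_⟩
    have := hE.comp_mem _ hU' _ hV'
    rwa [sandwich_comp, ← star_mul] at this

theorem IsClosedConvexClass.isClosed_unitaries (hE : IsClosedConvexClass S E) :
    IsClosed (hE.unitaries : Set (Op n)) :=
  isClosed_unitary.inter (hE.closed.preimage continuous_sandwich_star)

theorem IsClosedConvexClass.mem_infinitesimalGenerators (hE : IsClosedConvexClass S E)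
    {A : Op n} (hA : Aᴴ = -A) (hAS : A ∈ Submodule.span ℂ S) :
    A ∈ infinitesimalGenerators hE.unitaries := by
  have key : ∀ B : Op n, Bᴴ = -B → B ∈ Submodule.span ℂ S → ∀ t : ℝ, 0 ≤ t →
      NormedSpace.exp (t • B) ∈ hE.unitaries := by
    intro B hB hBS t ht
    refine ⟨exp_real_smul_mem_unitary hB t, ?_⟩
    have h := hE.unitary_mem (-Complex.I • B)
      (by simp [Matrix.IsHermitian, Matrix.conjTranspose_smul, hB])
      (by simpa [smul_smul] using hBS) t ht
    have e1 : (t * Complex.I : ℂ) • (-Complex.I • B) = t • B := by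
      rw [smul_smul, ← Complex.coe_smul]
      congr 1
      linear_combination (-(t : ℂ)) * Complex.I_mul_I
    have e2 : star (NormedSpace.exp (t • B)) =
        NormedSpace.exp (-(t * Complex.I : ℂ) • (-Complex.I • B)) := by
      rw [NormedSpace.star_exp, neg_smul, e1, ← Complex.coe_smul, star_smul,
        Matrix.star_eq_conjTranspose, hB]
      simp
    rw [unitaryEvolution, e1, ← e2] at h
    exact h
  refine ⟨hA, fun t => ?_⟩
  -- The unitary rule covers only nonnegative times; negative times come from `-A`, which is also in
  -- the span.
  rcases le_total 0 t with ht | ht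
  · exact key A hA hAS t ht
  · have := key (-A) (by simp [hA]) (neg_mem hAS) (-t) (by linarith)
    simpa using this

/-- The generators of the unitary evolutions in `E`, as a real Lie algebra. -/
def IsClosedConvexClass.lieAlgebra (hE : IsClosedConvexClass S E) : LieSubalgebra ℝ (Op n) where
  carrier := infinitesimalGenerators hE.unitaries
  zero_mem' := zero_mem_infinitesimalGenerators
  add_mem' := add_mem_infinitesimalGenerators hE.isClosed_unitaries
  smul_mem' := smul_mem_infinitesimalGenerators
  lie_mem' := lie_mem_infinitesimalGenerators hE.isClosed_unitaries

theorem IsClosedConvexClass.su_le_lieAlgebra (hE : IsClosedConvexClass S E) {T : Set (Op n)}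
    (hT : IsHormander T) (hTS : T ⊆ Submodule.span ℂ S) : su n ≤ hE.lieAlgebra := by
  rw [← hT.2, LieSubalgebra.lieSpan_le]
  exact fun A hA => hE.mem_infinitesimalGenerators (hT.1 A hA) (hTS hA)

/-- Every Hermitian involution is, up to a phase, the exponential of an element of `𝔰𝔲(n)`. -/
theorem IsClosedConvexClass.sandwich_involution_mem [Nonempty n] (hE : IsClosedConvexClass S E)
    (hsu : su n ≤ hE.lieAlgebra) {W : Op n} (hW : Wᴴ = W) (hWW : W * W = 1) :
    sandwich W W ∈ E := by
  let _ := NormedAlgebra.restrictScalars ℚ ℂ (Op n)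
  set P : Op n := (2⁻¹ : ℂ) • (1 - W) with hP
  have hPid : IsIdempotentElem P := by
    rw [IsIdempotentElem, hP, smul_mul_smul_comm]
    have : (1 - W) * (1 - W) = (2 : ℂ) • (1 - W) := by
      rw [two_smul, sub_mul, mul_sub, mul_sub, hWW]; simp; abel
    rw [this, smul_smul]; norm_num
  have hPs : Pᴴ = P := by simp [hP, Matrix.conjTranspose_smul, hW]
  -- Subtracting the normalized trace of `P` makes the generator traceless. It is real, so it
  -- contributes only a phase.
  set c : ℂ := (Fintype.card n : ℂ)⁻¹ * P.trace with hc
  have hcs : star c = c := by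
    rw [hc, star_mul', ← Matrix.trace_conjTranspose, hPs]; simp
  set X : Op n := Complex.I • (P - c • 1) with hX
  have hXsu : X ∈ su n := by
    refine ⟨?_, ?_⟩
    · simp only [hX, Matrix.conjTranspose_smul, Matrix.conjTranspose_sub, hPs, hcs,
        Matrix.conjTranspose_one]
      simp
    · simp [hX, hc, Matrix.trace_smul, mul_right_comm]
  have hmem := (hsu hXsu).2 Real.pi
  have hexp : NormedSpace.exp (Real.pi • X) = Complex.exp (-(Real.pi * Complex.I * c)) • W := by
    have h1 : Real.pi • X = (Real.pi * Complex.I : ℂ) • P +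
        (-(Real.pi * Complex.I * c) : ℂ) • (1 : Op n) := by
      rw [hX, ← Complex.coe_smul, smul_smul, smul_sub, smul_smul _ c, neg_smul, sub_eq_add_neg]
    rw [h1, NormedSpace.exp_add_of_commute ((Commute.one_right _).smul_right _),
      exp_smul_of_isIdempotentElem hPid, exp_smul_of_isIdempotentElem IsIdempotentElem.one, Complex.exp_pi_mul_I]
    -- Since `e^{iπ} = -1`, the exponential of `iπP` is `1 - 2P`.
    have h2 : (1 : Op n) + (-1 - 1 : ℂ) • P = W := by
      rw [hP, smul_smul]; norm_num
    rw [h2, sub_smul, one_smul, add_sub_cancel, mul_smul_comm, mul_one]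
  rw [hexp] at hmem
  have h := hmem.2
  rw [star_smul, sandwich_smul_smul] at h
  have hz : ‖Complex.exp (-(Real.pi * Complex.I * c))‖ = 1 := by
    rw [Complex.norm_exp]
    have : c.im = 0 := Complex.conj_eq_iff_im.1 hcs
    simp [this]
  have hz' := Complex.mul_conj' (Complex.exp (-(Real.pi * Complex.I * c)))
  rw [hz] at hz'
  rw [Complex.star_def, hz', Matrix.star_eq_conjTranspose, hW] at h
  simpa using h

end Evolutions

/-! ### The large-time limit of a jump evolution -/

section Damping

variable {n : Type} [Fintype n] [DecidableEq n] {S : Set (Op n)} {E : Set (SuperOp n)}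

theorem sandwich_mul (A B C D : Op n) :
    sandwich A B * sandwich C D = sandwich (A * C) (D * B) :=
  sandwich_comp A B C D

/-- The limit of the evolutions `e^{t L_a}` for a partial isometry `a` with `a² = 0`. -/
def damping (a : Op n) : SuperOp n :=
  sandwich (1 - aᴴ * a) (1 - aᴴ * a) + sandwich a aᴴ

theorem damping_apply (a ρ : Op n) :
    damping a ρ = (1 - aᴴ * a) * ρ * (1 - aᴴ * a) + a * ρ * aᴴ := rfl

/-- With the projection `N = a* a`, `P` extracts the off-diagonal blocks `Nρ(1-N) + (1-N)ρN`, which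
decay at rate 1. The map `Q`, `ρ ↦ NρN - aρa*`, governs the transfer of the `N`-block by `a`, at
rate 2. The relation `a² = 0` gives `Na = 0`: the transferred block leaves the range of `N`. -/
theorem exists_spectral_decomposition_lindblad {a : Op n} (h0 : a * a = 0)
    (h1 : a * aᴴ * a = a) : ∃ P Q : SuperOp n, IsIdempotentElem P ∧ IsIdempotentElem Q ∧
      P * Q = 0 ∧ Q * P = 0 ∧ lindblad a = -P - (2 : ℂ) • Q ∧ damping a = 1 - P - Q := by
  set N : Op n := aᴴ * a with hN
  have haN : a * N = a := by rw [hN, ← mul_assoc, h1]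
  have hNN : N * N = N := by
    nth_rw 1 [hN]; rw [mul_assoc, haN]
  have hNa : N * a = 0 := by rw [hN, mul_assoc, h0, mul_zero]
  have hNs : Nᴴ = N := by simp [hN]
  have hNas : N * aᴴ = aᴴ := by
    rw [← hNs, ← Matrix.conjTranspose_mul, haN]
  have hasN : aᴴ * N = 0 := by
    rw [← hNs, ← Matrix.conjTranspose_mul, hNa, Matrix.conjTranspose_zero]
  have hass : aᴴ * aᴴ = 0 := by
    rw [← Matrix.conjTranspose_mul, h0, Matrix.conjTranspose_zero]
  have hz1 : ∀ A : Op n, sandwich A 0 = 0 := fun A => by ext1; simp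
  have hz2 : ∀ A : Op n, sandwich 0 A = 0 := fun A => by ext1; simp
  set P : SuperOp n := sandwich N 1 + sandwich 1 N - (sandwich N N + sandwich N N) with hP
  set Q : SuperOp n := sandwich N N - sandwich a aᴴ with hQ
  have hPP : IsIdempotentElem P := by
    simp only [IsIdempotentElem, hP, mul_sub, sub_mul, mul_add, add_mul, sandwich_mul, hNN,
      mul_one, one_mul]
    abel
  have hQQ : IsIdempotentElem Q := by
    simp only [IsIdempotentElem, hQ, mul_sub, sub_mul, sandwich_mul, hNN, haN, hNa, hNas, hasN,
      h0, hass, hz1]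
    abel
  have hPQ : P * Q = 0 := by
    simp only [hP, hQ, mul_sub, sub_mul, add_mul, sandwich_mul, hNN, hNa, hasN, mul_one,
      one_mul, hz1, hz2]
    abel
  have hQP : Q * P = 0 := by
    simp only [hP, hQ, mul_sub, sub_mul, mul_add, sandwich_mul, hNN, haN, hNas, mul_one,
      one_mul]
    abel
  have hL : lindblad a = -P - (2 : ℂ) • Q := by
    rw [lindblad, ← hN, hP, hQ]
    module
  have hlim : damping a = 1 - P - Q := by
    ext1 ρ
    simp only [damping_apply, hP, hQ, ← hN, add_apply, sub_apply, one_apply_eq_self,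
      sandwich_apply]
    noncomm_ring
  exact ⟨P, Q, hPP, hQQ, hPQ, hQP, hL, hlim⟩

theorem tendsto_jumpEvolution {a : Op n} (h0 : a * a = 0) (h1 : a * aᴴ * a = a) :
    Tendsto (jumpEvolution a) atTop (𝓝 (damping a)) := by
  obtain ⟨P, Q, hP, hQ, hPQ, hQP, hL, hlim⟩ := exists_spectral_decomposition_lindblad h0 h1
  unfold jumpEvolution
  rw [hlim, hL]
  exact tendsto_exp_of_orthogonal_idempotents hP hQ hPQ hQP

theorem IsClosedConvexClass.damping_mem (hE : IsClosedConvexClass S E) {a : Op n} (ha : a ∈ S)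
    (h0 : a * a = 0) (h1 : a * aᴴ * a = a) : damping a ∈ E :=
  hE.closed.mem_of_tendsto (tendsto_jumpEvolution h0 h1) <|
    (eventually_ge_atTop 0).mono fun t ht => hE.jump_mem a ha t ht

theorem damping_conj {W : Op n} (hW : Wᴴ = W) (hWW : W * W = 1) (a : Op n) :
    (sandwich W W).comp ((damping a).comp (sandwich W W)) = damping (W * a * W) := by
  have h : (W * a * W)ᴴ * (W * a * W) = W * (aᴴ * a) * W := by
    rw [Matrix.conjTranspose_mul, Matrix.conjTranspose_mul, hW]
    calc W * (aᴴ * W) * (W * a * W) = W * aᴴ * (W * W) * a * W := by noncomm_ring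
      _ = _ := by rw [hWW]; noncomm_ring
  have h' : 1 - W * (aᴴ * a) * W = W * (1 - aᴴ * a) * W := by
    rw [mul_sub, sub_mul, mul_one, hWW]
  ext1 ρ
  rw [ContinuousLinearMap.comp_apply, ContinuousLinearMap.comp_apply, damping_apply,
    damping_apply, h, h', sandwich_apply, sandwich_apply, Matrix.conjTranspose_mul,
    Matrix.conjTranspose_mul, hW]
  noncomm_ring

theorem trace_damping {a : Op n} (h1 : a * aᴴ * a = a) (ρ : Op n) :
    (damping a ρ).trace = ρ.trace := by
  have hNN : aᴴ * a * (aᴴ * a) = aᴴ * a := by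
    rw [mul_assoc, ← mul_assoc a, h1]
  have h : (1 - aᴴ * a) * (1 - aᴴ * a) + aᴴ * a = 1 := by
    rw [sub_mul, mul_sub, mul_sub, hNN]; simp
  rw [damping_apply, Matrix.trace_add, Matrix.trace_mul_comm, ← mul_assoc,
    Matrix.trace_mul_comm (a * ρ), ← mul_assoc, ← Matrix.trace_add, ← add_mul, h, one_mul]

theorem number_mul_damping {a : Op n} (h0 : a * a = 0) (h1 : a * aᴴ * a = a) (ρ : Op n) :
    aᴴ * a * damping a ρ = 0 ∧ damping a ρ * (aᴴ * a) = 0 := by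
  have hNN : aᴴ * a * (aᴴ * a) = aᴴ * a := by
    rw [mul_assoc, ← mul_assoc a, h1]
  have hNa : aᴴ * a * a = 0 := by rw [mul_assoc, h0, mul_zero]
  have haN : aᴴ * (aᴴ * a) = 0 := by
    rw [← mul_assoc, ← Matrix.conjTranspose_mul, h0]; simp
  have hl : aᴴ * a * (1 - aᴴ * a) = 0 := by rw [mul_sub, hNN, mul_one, sub_self]
  have hr : (1 - aᴴ * a) * (aᴴ * a) = 0 := by rw [sub_mul, hNN, one_mul, sub_self]
  constructor
  · rw [damping_apply, mul_add, ← mul_assoc, ← mul_assoc, hl, ← mul_assoc (aᴴ * a) (a * ρ),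
      ← mul_assoc (aᴴ * a) a, hNa]
    simp
  · rw [damping_apply, add_mul, mul_assoc, hr, mul_assoc (a * ρ), haN]
    simp

/-- Applied with `N` the number operator of a qubit already reset: damping another qubit leaves it
reset. -/
theorem mul_damping_eq_zero {a N ρ : Op n} (hN : Commute N a) (hN' : Commute N aᴴ) :
    (N * ρ = 0 → N * damping a ρ = 0) ∧ (ρ * N = 0 → damping a ρ * N = 0) := by
  have hc : Commute N (1 - aᴴ * a) := (Commute.one_right N).sub_right (hN'.mul_right hN)
  constructor <;> intro h
  · rw [damping_apply, mul_add, ← mul_assoc, ← mul_assoc, hc.eq, mul_assoc _ N, h,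
      ← mul_assoc, ← mul_assoc, hN.eq, mul_assoc a N, h]
    simp
  · rw [damping_apply, add_mul, mul_assoc, ← hc.eq, ← mul_assoc, mul_assoc _ ρ N, h,
      mul_assoc (a * ρ), ← hN'.eq, ← mul_assoc, mul_assoc a ρ N, h]
    simp

end Damping

/-! ### From one pure replacer to all densities -/

section PureStates

variable {n : Type} [Fintype n] [DecidableEq n] {S : Set (Op n)} {E : Set (SuperOp n)}

/-- A Householder reflection moves a basis vector to a given unit vector, up to a phase. -/
theorem exists_involution_mulVec_single (i : n) (u : n → ℂ) (hu : star u ⬝ᵥ u = 1) :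
    ∃ W : Op n, Wᴴ = W ∧ W * W = 1 ∧ ∃ z : ℂ, z * star z = 1 ∧ W *ᵥ Pi.single i 1 = z • u := by
  -- The phase makes coordinate `i` of `z • u` real, so its inner product with the basis vector is
  -- symmetric, as a reflection exchanging the two requires.
  obtain ⟨z, hz, hzu⟩ : ∃ z : ℂ, z * star z = 1 ∧ star (z * u i) = z * u i := by
    by_cases h : u i = 0
    · exact ⟨1, by simp, by simp [h]⟩
    · have hn : (‖u i‖ : ℂ) ≠ 0 := by simpa using h
      refine ⟨star (u i) / ‖u i‖, ?_, ?_⟩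
      · simp only [star_div₀, Complex.star_def, Complex.conj_ofReal, Complex.conj_conj]
        rw [div_mul_div_comm, Complex.conj_mul']
        field_simp
      · simp only [star_div₀, star_mul', Complex.star_def, Complex.conj_ofReal, Complex.conj_conj]
        ring
  set e : n → ℂ := Pi.single i 1 with he
  set v : n → ℂ := z • u with hv
  have hvv : star v ⬝ᵥ v = 1 := by
    rw [hv, star_smul, smul_dotProduct, dotProduct_smul, hu]
    simp only [smul_eq_mul, mul_one]
    rw [mul_comm, hz]
  have hee : star e ⬝ᵥ e = 1 := by simp [he]
  have hve : star v ⬝ᵥ e = v i := by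
    simp only [he, dotProduct_single, mul_one, Pi.star_apply]; exact hzu
  have hev : star e ⬝ᵥ v = v i := by simp [he]
  set d : n → ℂ := e - v with hd
  set δ : ℂ := star d ⬝ᵥ d with hδ
  have hδ' : δ = 2 - 2 * v i := by
    rw [hδ, hd, star_sub, sub_dotProduct, dotProduct_sub, dotProduct_sub, hee, hve, hev, hvv]
    ring
  have hde : star d ⬝ᵥ e = δ / 2 := by
    rw [hδ', hd, star_sub, sub_dotProduct, hee, hve]; ring
  have hδs : star δ = δ := by
    rw [hδ, ← Matrix.star_dotProduct]
  -- If `δ = 0` the two vectors coincide and the identity works. Otherwise `⟨d, e⟩ = δ/2`, so the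
  -- reflection `1 - (2/δ) d d*` sends `e` to `e - d = v`.
  by_cases hδ0 : δ = 0
  · have : d = 0 := dotProduct_star_self_eq_zero.1 hδ0
    refine ⟨1, by simp, by simp, z, hz, ?_⟩
    rw [Matrix.one_mulVec]
    exact sub_eq_zero.1 this
  · set D : Op n := Matrix.vecMulVec d (star d) with hD
    have hDs : Dᴴ = D := by rw [hD, Matrix.conjTranspose_vecMulVec, star_star]
    have hDD : D * D = δ • D := by
      rw [hD, Matrix.vecMulVec_mul_vecMulVec, ← hδ, Matrix.vecMulVec_smul]
    refine ⟨1 - (2 / δ) • D, ?_, ?_, z, hz, ?_⟩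
    · rw [Matrix.conjTranspose_sub, Matrix.conjTranspose_smul, hDs, star_div₀, hδs]
      simp
    · rw [sub_mul, mul_sub, mul_sub, smul_mul_smul_comm, hDD, smul_smul]
      have : 2 / δ * (2 / δ) * δ = 2 / δ + 2 / δ := by field_simp; norm_num
      rw [this, add_smul]; simp
    · rw [Matrix.sub_mulVec, Matrix.one_mulVec, Matrix.smul_mulVec, hD,
        Matrix.vecMulVec_mulVec, hde, op_smul_eq_smul, smul_smul]
      have : 2 / δ * (δ / 2) = 1 := by field_simp
      rw [this, one_smul, hd, sub_sub_cancel]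

theorem sandwich_comp_replacer (A B σ : Op n) :
    (sandwich A B).comp (replacer σ) = replacer (A * σ * B) := by
  ext1 ρ; simp

theorem IsClosedConvexClass.replacer_pure_mem (hE : IsClosedConvexClass S E)
    (hinv : ∀ W : Op n, Wᴴ = W → W * W = 1 → sandwich W W ∈ E) {i : n}
    (hi : replacer (Matrix.single i i 1) ∈ E) (u : n → ℂ) (hu : star u ⬝ᵥ u = 1) :
    replacer (Matrix.vecMulVec u (star u)) ∈ E := by
  obtain ⟨W, hW, hWW, z, hz, hWu⟩ := exists_involution_mulVec_single i u hu
  have h := hE.comp_mem _ (hinv W hW hWW) _ hi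
  have e : W * Matrix.single i i 1 * W = Matrix.vecMulVec u (star u) := by
    have h1 : (Matrix.single i i 1 : Op n) =
        Matrix.vecMulVec (Pi.single i 1) (star (Pi.single i 1)) := by
      rw [Matrix.single_eq_single_vecMulVec_single]
      congr 1
      ext j
      by_cases hj : j = i
      · subst hj; simp
      · simp [hj]
    have h2 : star (Pi.single i (1 : ℂ)) ᵥ* W = star (W *ᵥ Pi.single i 1) := by
      rw [Matrix.star_mulVec, hW]
    rw [h1, Matrix.mul_vecMulVec, Matrix.vecMulVec_mul, h2, hWu, star_smul,
      Matrix.smul_vecMulVec, Matrix.vecMulVec_smul, smul_smul, hz, one_smul]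
  rwa [sandwich_comp_replacer, e] at h

theorem eq_sum_eigenvalues_smul {σ : Op n} (hσ : σ.IsHermitian) :
    σ = ∑ i, (hσ.eigenvalues i : ℂ) • Matrix.vecMulVec
      (fun x => (hσ.eigenvectorUnitary : Op n) x i)
      (star fun x => (hσ.eigenvectorUnitary : Op n) x i) := by
  conv_lhs => rw [hσ.spectral_theorem]
  rw [Unitary.conjStarAlgAut_apply]
  ext x y
  rw [Matrix.mul_apply, Matrix.sum_apply]
  refine Finset.sum_congr rfl fun i _ => ?_
  simp [Matrix.mul_diagonal, Matrix.vecMulVec_apply, Matrix.star_apply]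
  ring

/-- The eigenvalues of a density are convex weights, and `replacer` is linear in its target, so the
spectral decomposition is a convex combination of pure replacers. -/
theorem IsClosedConvexClass.replacer_mem (hE : IsClosedConvexClass S E)
    (hinv : ∀ W : Op n, Wᴴ = W → W * W = 1 → sandwich W W ∈ E) {i : n}
    (hi : replacer (Matrix.single i i 1) ∈ E) {σ : Op n} (hσ : σ ∈ densities n) :
    replacer σ ∈ E := by
  have hσH := hσ.1.isHermitian
  have hsum : ∑ i, hσH.eigenvalues i = 1 := by
    have := hσH.trace_eq_sum_eigenvalues
    rw [hσ.2] at this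
    exact Complex.ofReal_injective (by simpa using this.symm)
  have h := hE.convex.sum_mem (t := Finset.univ) (w := hσH.eigenvalues)
    (z := fun i => replacer (Matrix.vecMulVec
      (fun x => (hσH.eigenvectorUnitary : Op n) x i)
      (star fun x => (hσH.eigenvectorUnitary : Op n) x i)))
    (fun i _ => hσ.1.eigenvalues_nonneg i) hsum fun i _ => by
      refine hE.replacer_pure_mem hinv hi _ ?_
      have := congrFun (congrFun (Unitary.coe_star_mul_self hσH.eigenvectorUnitary) i) i
      simpa [Matrix.mul_apply, dotProduct, Matrix.star_apply] using this
  convert h using 1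
  ext1 ρ
  conv_lhs => rw [eq_sum_eigenvalues_smul hσH]
  simp only [replacer_apply, sum_apply, Finset.smul_sum,
    smul_apply]
  refine Finset.sum_congr rfl fun i _ => ?_
  rw [smul_comm, Complex.coe_smul]

end PureStates

/-! ### Qubit operators, swaps and the full reset -/

section Tensor

variable {k : ℕ}

theorem tensorOp_mul (A B : Fin k → Op (Fin 2)) :
    tensorOp A * tensorOp B = tensorOp fun j => A j * B j := by
  ext x y
  simp only [tensorOp, Matrix.mul_apply, Matrix.of_apply, ← Finset.prod_mul_distrib,
    Finset.prod_univ_sum, Fintype.piFinset_univ]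

theorem conjTranspose_tensorOp (A : Fin k → Op (Fin 2)) :
    (tensorOp A)ᴴ = tensorOp fun j => (A j)ᴴ := by
  ext x y
  simp [tensorOp, Matrix.conjTranspose_apply]

theorem tensorOp_eq_zero {A : Fin k → Op (Fin 2)} {j : Fin k} (h : A j = 0) :
    tensorOp A = 0 := by
  ext x y
  exact Finset.prod_eq_zero (Finset.mem_univ j) (by simp [h])

/-- The operator that acts as `A` on qubit `j`. -/
def onQubit (j : Fin k) (A : Op (Fin 2)) : Op (Qubits k) :=
  tensorOp fun l => if l = j then A else 1

theorem onQubit_mul (j : Fin k) (A B : Op (Fin 2)) :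
    onQubit j A * onQubit j B = onQubit j (A * B) := by
  rw [onQubit, onQubit, onQubit, tensorOp_mul]
  congr 1; ext1 l; split_ifs <;> simp

theorem conjTranspose_onQubit (j : Fin k) (A : Op (Fin 2)) :
    (onQubit j A)ᴴ = onQubit j Aᴴ := by
  rw [onQubit, onQubit, conjTranspose_tensorOp]
  congr 1; ext1 l; split_ifs <;> simp

theorem onQubit_zero (j : Fin k) : onQubit j 0 = 0 :=
  tensorOp_eq_zero (j := j) (by simp)

theorem commute_onQubit {i j : Fin k} (h : i ≠ j) (A B : Op (Fin 2)) :
    Commute (onQubit i A) (onQubit j B) := by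
  rw [Commute, SemiconjBy, onQubit, onQubit, tensorOp_mul, tensorOp_mul]
  congr 1; ext1 l
  split_ifs with h1 h2
  · exact absurd (h1.symm.trans h2) h
  all_goals simp

theorem onQubit_diagonal (j : Fin k) (d : Fin 2 → ℂ) :
    onQubit j (Matrix.diagonal d) = Matrix.diagonal fun x => d (x j) := by
  ext x y
  simp only [onQubit, tensorOp, Matrix.of_apply]
  by_cases hxy : x = y
  · subst hxy
    rw [Matrix.diagonal_apply_eq, Finset.prod_eq_single j]
    · simp
    · intro l _ hl; simp [hl]
    · simp
  · rw [Matrix.diagonal_apply_ne _ hxy]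
    obtain ⟨l, hl⟩ := Function.ne_iff.1 hxy
    refine Finset.prod_eq_zero (Finset.mem_univ l) ?_
    split_ifs <;> simp [hl]

theorem ketZeroBraOne_mul_self : ketZeroBraOne * ketZeroBraOne = 0 := by
  simp [ketZeroBraOne]

theorem ketZeroBraOne_isometry :
    ketZeroBraOne * ketZeroBraOneᴴ * ketZeroBraOne = ketZeroBraOne := by
  simp [ketZeroBraOne, Matrix.conjTranspose_single]

theorem number_ketZeroBraOne :
    ketZeroBraOneᴴ * ketZeroBraOne = Matrix.diagonal ![0, 1] := by
  ext i j
  fin_cases i <;> fin_cases j <;>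
    simp [ketZeroBraOne, Matrix.conjTranspose_single]

/-- The exchange of the qubits `i` and `j`. -/
def qubitSwap (i j : Fin k) : Op (Qubits k) :=
  Matrix.of fun x y => if y = x ∘ Equiv.swap i j then 1 else 0

theorem comp_swap_comp_swap (i j : Fin k) (x : Qubits k) :
    (x ∘ Equiv.swap i j) ∘ Equiv.swap i j = x := by
  ext l; simp

theorem eq_comp_swap_iff (i j : Fin k) (x y : Qubits k) :
    y = x ∘ Equiv.swap i j ↔ x = y ∘ Equiv.swap i j := by
  constructor <;> rintro rfl <;> rw [comp_swap_comp_swap]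

theorem conjTranspose_qubitSwap (i j : Fin k) : (qubitSwap i j)ᴴ = qubitSwap i j := by
  ext x y
  simp only [qubitSwap, Matrix.conjTranspose_apply, Matrix.of_apply, eq_comp_swap_iff i j y x]
  split_ifs <;> simp

theorem qubitSwap_mul_apply (i j : Fin k) (A : Op (Qubits k)) (x y : Qubits k) :
    (qubitSwap i j * A) x y = A (x ∘ Equiv.swap i j) y := by
  simp [Matrix.mul_apply, qubitSwap]

theorem mul_qubitSwap_apply (i j : Fin k) (A : Op (Qubits k)) (x y : Qubits k) :
    (A * qubitSwap i j) x y = A x (y ∘ Equiv.swap i j) := by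
  simp only [Matrix.mul_apply, qubitSwap, Matrix.of_apply, eq_comp_swap_iff i j _ y]
  simp

theorem qubitSwap_mul_self (i j : Fin k) : qubitSwap i j * qubitSwap i j = 1 := by
  ext x y
  rw [qubitSwap_mul_apply]
  simp [qubitSwap, comp_swap_comp_swap, Matrix.one_apply, eq_comm]

theorem qubitSwap_conj_onQubit (i j : Fin k) (A : Op (Fin 2)) :
    qubitSwap i j * onQubit i A * qubitSwap i j = onQubit j A := by
  ext x y
  rw [mul_qubitSwap_apply, qubitSwap_mul_apply]
  simp only [onQubit, tensorOp, Matrix.of_apply, Function.comp_apply]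
  rw [← Equiv.prod_comp (Equiv.swap i j)]
  simp [Equiv.swap_apply_eq_iff]

variable {S : Set (Op (Qubits k))} {E : Set (SuperOp (Qubits k))}

/-- Conjugating by the swap of `i` and `j` moves the reset from `i` to `j`; for `j = i` the swap is
the identity, so no case split is needed. -/
theorem IsClosedConvexClass.damping_onQubit_mem (hE : IsClosedConvexClass S E)
    (hinv : ∀ W : Op (Qubits k), Wᴴ = W → W * W = 1 → sandwich W W ∈ E) {i : Fin k}
    (hi : onQubit i ketZeroBraOne ∈ S) (j : Fin k) :
    damping (onQubit j ketZeroBraOne) ∈ E := by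
  have h := hE.damping_mem hi
    (by rw [onQubit_mul, ketZeroBraOne_mul_self, onQubit_zero])
    (by rw [conjTranspose_onQubit, onQubit_mul, onQubit_mul, ketZeroBraOne_isometry])
  have hW := hinv (qubitSwap i j) (conjTranspose_qubitSwap i j) (qubitSwap_mul_self i j)
  rw [← qubitSwap_conj_onQubit i j, ← damping_conj (conjTranspose_qubitSwap i j)
    (qubitSwap_mul_self i j)]
  exact hE.comp_mem _ hW _ (hE.comp_mem _ h _ hW)

/-- Some channel in `E` resets all the qubits in a given set. -/
theorem IsClosedConvexClass.exists_reset (hE : IsClosedConvexClass S E)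
    (hd : ∀ j : Fin k, damping (onQubit j ketZeroBraOne) ∈ E) (s : Finset (Fin k)) :
    ∃ Φ ∈ E, ∀ ρ, (Φ ρ).trace = ρ.trace ∧ ∀ j ∈ s,
      onQubit j (Matrix.diagonal ![0, 1]) * Φ ρ = 0 ∧
      Φ ρ * onQubit j (Matrix.diagonal ![0, 1]) = 0 := by
  induction s using Finset.induction_on with
  | empty => exact ⟨sandwich 1 1, hE.sandwich_one_mem, fun ρ => by simp⟩
  | insert j s hj ih =>
    obtain ⟨Φ, hΦ, hρ⟩ := ih
    have h0 : onQubit j ketZeroBraOne * onQubit j ketZeroBraOne = 0 := by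
      rw [onQubit_mul, ketZeroBraOne_mul_self, onQubit_zero]
    have h1 : onQubit j ketZeroBraOne * (onQubit j ketZeroBraOne)ᴴ * onQubit j ketZeroBraOne =
        onQubit j ketZeroBraOne := by
      rw [conjTranspose_onQubit, onQubit_mul, onQubit_mul, ketZeroBraOne_isometry]
    have hN : (onQubit j ketZeroBraOne)ᴴ * onQubit j ketZeroBraOne =
        onQubit j (Matrix.diagonal ![0, 1]) := by
      rw [conjTranspose_onQubit, onQubit_mul, number_ketZeroBraOne]
    refine ⟨_, hE.comp_mem _ (hd j) _ hΦ, fun ρ => ⟨?_, fun i hi => ?_⟩⟩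
    · rw [ContinuousLinearMap.comp_apply, trace_damping h1, (hρ ρ).1]
    · rw [ContinuousLinearMap.comp_apply]
      by_cases hij : i = j
      · subst hij
        rw [← hN]
        exact number_mul_damping h0 h1 _
      · have hi' := (hρ ρ).2 i (Finset.mem_of_mem_insert_of_ne hi hij)
        have hc := mul_damping_eq_zero (ρ := Φ ρ)
          (commute_onQubit hij (Matrix.diagonal ![0, 1]) ketZeroBraOne)
          (by rw [conjTranspose_onQubit]; exact commute_onQubit hij _ _)
        exact ⟨hc.1 hi'.1, hc.2 hi'.2⟩

/-- After a full reset, every number operator annihilates the output from both sides. Any nonzero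
bit in a row or column index therefore kills that entry; the one surviving entry must carry the
preserved trace. -/
theorem IsClosedConvexClass.replacer_zero_mem (hE : IsClosedConvexClass S E)
    (hd : ∀ j : Fin k, damping (onQubit j ketZeroBraOne) ∈ E) :
    replacer (Matrix.single (0 : Qubits k) 0 1) ∈ E := by
  obtain ⟨Φ, hΦ, hρ⟩ := hE.exists_reset hd Finset.univ
  have key : ∀ ρ : Op (Qubits k), ∀ x y, ¬(x = 0 ∧ y = 0) → Φ ρ x y = 0 := by
    intro ρ x y hxy
    have hb : ∀ b : Fin 2, b ≠ 0 → (![0, 1] : Fin 2 → ℂ) b = 1 := by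
      intro b hb; fin_cases b <;> simp_all
    rw [not_and_or] at hxy
    rcases hxy with h | h
    · obtain ⟨j, hj⟩ := Function.ne_iff.1 h
      have h2 := congrFun (congrFun ((hρ ρ).2 j (Finset.mem_univ j)).1 x) y
      rwa [onQubit_diagonal, Matrix.diagonal_mul, hb _ hj, one_mul] at h2
    · obtain ⟨j, hj⟩ := Function.ne_iff.1 h
      have h2 := congrFun (congrFun ((hρ ρ).2 j (Finset.mem_univ j)).2 x) y
      rwa [onQubit_diagonal, Matrix.mul_diagonal, hb _ hj, mul_one] at h2
  convert hΦ using 1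
  ext1 ρ
  ext x y
  rw [replacer_apply, ← (hρ ρ).1, Matrix.smul_apply]
  by_cases hxy : x = 0 ∧ y = 0
  · obtain ⟨rfl, rfl⟩ := hxy
    rw [Matrix.trace, Finset.sum_eq_single 0]
    · simp
    · intro x _ hx; exact key ρ x x fun h => hx h.1
    · simp
  · rw [key ρ x y hxy, Matrix.single_apply_of_ne, smul_zero]
    exact fun h => hxy ⟨h.1.symm, h.2.symm⟩

end Tensor

end QControl

end

theorem theorem2p8 (k : ℕ) (hk : 1 ≤ k) (S : Set (QControl.Op (QControl.Qubits k)))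
    (hS : ∃ T : Set (QControl.Op (QControl.Qubits k)),
      QControl.IsHormander T ∧ T ⊆ Submodule.span ℂ S)
    (ha : QControl.firstQubitLowering k hk ∈ S) :
    (∀ σ ∈ QControl.densities (QControl.Qubits k),
      QControl.replacer σ ∈ QControl.closedConvexChan S) ∧
    QControl.IsTransitive (QControl.closedConvexChan S) := by
  obtain ⟨T, hT, hTS⟩ := hS
  have hR : ∀ σ ∈ QControl.densities (QControl.Qubits k),
      QControl.replacer σ ∈ QControl.closedConvexChan S := by
    intro σ hσ E hE
    replace hE : QControl.IsClosedConvexClass S E := hE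
    have hinv : ∀ W : QControl.Op (QControl.Qubits k), W.conjTranspose = W → W * W = 1 →
        QControl.sandwich W W ∈ E := fun W hW hWW =>
      hE.sandwich_involution_mem (hE.su_le_lieAlgebra hT hTS) hW hWW
    -- `firstQubitLowering k hk` is by definition `onQubit ⟨0, hk⟩ ketZeroBraOne`, so `ha` applies
    -- as it stands.
    exact hE.replacer_mem hinv (hE.replacer_zero_mem fun j =>
      hE.damping_onQubit_mem hinv (i := ⟨0, hk⟩) ha j) hσ
  refine ⟨hR, fun ρ hρ σ hσ => ⟨QControl.replacer σ, hR σ hσ, ?_⟩⟩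
  rw [QControl.replacer_apply, hρ.2, one_smul]
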